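/- For $S\subseteq\mathbb N$ let $\underline\rho(S)=\liminf_{n\to\infty}|S\cap\{0,\dots,n-1\}|/n$ be its lower density. Let $r\in[0,1]$. A set $B\subseteq\mathbb N$ is *partially computable at density $r$* if there is a partial computable function $\varphi$ with $\varphi(n)=B(n)$ for all $n\in\operatorname{dom}\varphi$ and $\underline\rho(\operatorname{dom}\varphi)\ge r$ (where $B(n)$ is the value at $n$ of the characteristic function of $B$). It is *coarsely computable at density $r$* if there is a computable set $C$ with $\underline\rho(\{n: B(n)=C(n)\})\ge r$. A set $A\subseteq\mathbb N$, viewed as a point of Cantor space $2^{\omega}$, is *weakly $n$-random* if it belongs to no (lightface) $\Pi^0_n$ class of $2^\omega$ of measure $0$ for the uniform (fair-coin) measure. Write $\le_{\mathrm T}$ for Turing reducibility and $\le_{\mathrm{tt}}$ for truth-table reducibility: $B\le_{\mathrm{tt}}A$ if there is a computable function that assigns to each $n$ a truth table (a finite list of queries to the oracle together with the finite list of accepted answer patterns) that is satisfied by $A$ if and only if $n\in B$. **Theorem 5.3.** Let $A,B\subseteq\mathbb N$ and $r\in[0,1]$. (i) If $A$ is weakly $1$-random, $B\le_{\mathrm{tt}}A$,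 and $B$ is partially computable at density $r$, then $B$ is coarsely computable at density $r$. (ii) If $A$ is weakly $2$-random, $B\le_{\mathrm T}A$, and $B$ is partially computable at density $r$, then $B$ is coarsely computable at density $r$. -/

import Mathlib

open MeasureTheory Filter

namespace CoarseComputability

noncomputable section

/-! ### Sets of natural numbers and their characteristic functions -/

open Classical in
/-- The characteristic sequence of `A ⊆ ω`, as a point of Cantor space `2^ω = (ℕ → Bool)`. -/
def charSeq (A : Set ℕ) : ℕ → Bool := fun n => decide (n ∈ A)

/-- The characteristic function of `A ⊆ ω` as a (total) function with values in `{0, 1}`. -/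
def charFun (A : Set ℕ) : ℕ →. ℕ := fun n => Part.some (charSeq A n).toNat

/-! ### Densities, partial and coarse computability at density `r` -/

/-- `ρ_n(A) = |A ∩ {0, …, n - 1}| / n` (only its values at `n ≥ 1` matter). -/
def rhoBelow (A : Set ℕ) (n : ℕ) : ℝ := ((A ∩ Set.Iio n).ncard : ℝ) / (n : ℝ)

/-- The lower density `liminf_n ρ_n(A)`. -/
def lowerDensity (A : Set ℕ) : ℝ := liminf (rhoBelow A) atTop

/-- `B` is partially computable at density `r`: some partial computable function agrees with `B`
on its domain, and its domain has lower density at least `r`. -/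
def PartiallyComputableAtDensity (B : Set ℕ) (r : ℝ) : Prop :=
  ∃ φ : ℕ →. Bool, Partrec φ ∧ (∀ n, ∀ b ∈ φ n, b = charSeq B n) ∧ r ≤ lowerDensity φ.Dom

/-- `B` is coarsely computable at density `r`: for some computable set `C`, the set
`{n : B(n) = C(n)}` has lower density at least `r`. -/
def CoarselyComputableAtDensity (B : Set ℕ) (r : ℝ) : Prop :=
  ∃ C : Set ℕ, ComputablePred (fun n => n ∈ C) ∧ r ≤ lowerDensity {n | n ∈ B ↔ n ∈ C}

/-! ### Reducibilities -/

/-- Turing reducibility `B ≤_T A` of sets of natural numbers. -/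
def SetTuringReducible (B A : Set ℕ) : Prop := TuringReducible (charFun B) (charFun A)

/-- A truth table: a finite list of queries and the list of those answer patterns that make
the table true. -/
abbrev TruthTable : Type := List ℕ × List (List Bool)

/-- `A` satisfies the truth table `t`: the answers of `A` to the queries are an accepted pattern. -/
def TruthTable.Sat (t : TruthTable) (A : Set ℕ) : Prop := t.1.map (charSeq A) ∈ t.2

/-- Truth-table reducibility `B ≤_tt A`: one can compute from `n` a truth table that `A` satisfies
if and only if `n ∈ B`. -/
def SetTTReducible (B A : Set ℕ) : Prop :=
  ∃ f : ℕ → TruthTable, Computable f ∧ ∀ n, n ∈ B ↔ TruthTable.Sat (f n) A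

/-! ### Effective Borel classes and weak randomness -/

/-- The basic clopen set `[σ]` of all `X ∈ 2^ω` that extend the finite binary string `σ`. -/
def cyl (σ : List Bool) : Set (ℕ → Bool) := {X | (List.range σ.length).map X = σ}

/-- Uniformly `Σ⁰_n` sequences of classes in `2^ω`. For `n = 0` these are the sequences of clopen
classes `⋃_{σ ∈ F k} [σ]` with `F` a computable sequence of finite sets of strings;
`Σ⁰_{n+1}` classes are effective unions of `Π⁰_n` classes, uniformly. -/
def UniformlySigma : ℕ → (ℕ → Set (ℕ → Bool)) → Prop
  | 0, U => ∃ F : ℕ → List (List Bool), Computable F ∧ ∀ k, U k = ⋃ σ ∈ F k, cyl σ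
  | n + 1, U => ∃ V : ℕ → Set (ℕ → Bool), UniformlySigma n V ∧
      ∀ k, U k = ⋃ j, (V (Nat.pair k j))ᶜ

/-- `P` is a `Σ⁰_n` class: a member of a uniformly `Σ⁰_n` sequence. -/
def IsSigmaClass (n : ℕ) (P : Set (ℕ → Bool)) : Prop :=
  ∃ U : ℕ → Set (ℕ → Bool), UniformlySigma n U ∧ U 0 = P

/-- `P` is a `Π⁰_n` class: its complement is a `Σ⁰_n` class. -/
def IsPiClass (n : ℕ) (P : Set (ℕ → Bool)) : Prop := IsSigmaClass n Pᶜ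

/-- Lebesgue (fair coin) measure on `2^ω`. -/
def cantorMeasure : Measure (ℕ → Bool) :=
  Measure.infinitePi (fun _ : ℕ => (PMF.uniformOfFintype Bool).toMeasure)

/-- `A` is weakly `n`-random: it belongs to no `Π⁰_n` class of measure `0`. -/
def WeaklyRandom (n : ℕ) (A : Set ℕ) : Prop :=
  ∀ P : Set (ℕ → Bool), IsPiClass n P → cantorMeasure P = 0 → charSeq A ∉ P

end

end CoarseComputability

/-
Let `Ψ` be a Turing functional with `Ψ A = B` and let `φ` be a partial computable function agreeing
with `B` on its domain. The oracles `X` for which `Ψ X` is total and extends `φ` form a `Π⁰_2`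
class, and a `Π⁰_1` class if `Ψ` is given by truth tables and hence total on every oracle. The class
contains `A`, so by weak randomness it has positive measure, and by Lebesgue density it fills more
than two thirds of some cylinder `[σ]`. For each `n` one of the two values is therefore output by
`Ψ X n` for more than a third of the `X` in `[σ]`; such a value `C n` can be found effectively, and
it is output by some `X` in the class, so `C n = φ n` whenever `φ n` is defined. Thus `C` agrees
with `B` on the domain of `φ`.
-/

namespace CoarseComputability

theorem exists_computable_choice {α β : Type*} [Primcodable α] [Primcodable β]
    {R : α → β → Prop} (hR : ComputablePred fun p : α × β => R p.1 p.2) (hex : ∀ a, ∃ b, R a b) :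
    ∃ f : α → β, Computable f ∧ ∀ a, R a (f a) := by
  classical
  obtain ⟨_, hR⟩ := hR
  let search (a : α) (m : ℕ) : Option β :=
    (Encodable.decode m).bind fun b => bif decide (R a b) then some b else none
  have htest : Computable₂ fun (q : α × ℕ) (b : β) => bif decide (R q.1 b) then some b else none :=
    Computable.cond
      ((hR.comp (Computable.pair (Computable.fst.comp Computable.fst) Computable.snd)).of_eq
        fun _ => by simp)
      (Computable.option_some.comp Computable.snd) (Computable.const none)
  have hsearch : Computable₂ search :=
    Computable.option_bind (Computable.decode.comp Computable.snd) htest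
  have hdom (a : α) : (Nat.rfindOpt (search a)).Dom := by
    obtain ⟨b, hb⟩ := hex a
    exact Nat.rfindOpt_dom.2 ⟨Encodable.encode b, b, by simp [search, hb]⟩
  refine ⟨fun a => (Nat.rfindOpt (search a)).get (hdom a),
    (Partrec.rfindOpt hsearch).of_eq fun a => (Part.some_get (hdom a)).symm, fun a => ?_⟩
  obtain ⟨m, hm⟩ := Nat.rfindOpt_spec (Part.get_mem (hdom a))
  obtain ⟨b, -, hb⟩ := Option.bind_eq_some_iff.1 hm
  by_cases h : R a b
  · rw [decide_eq_true h, cond_true, Option.some_inj] at hb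
    exact (congrArg (R a) hb).mp h
  · simp [h] at hb

theorem exists_primrec_stages {α β : Type*} [Primcodable α] [Primcodable β] {φ : α →. β}
    (hφ : Partrec φ) :
    ∃ d : ℕ → α → Option β, Primrec₂ d ∧ (∀ {s t n b}, s ≤ t → b ∈ d s n → b ∈ d t n) ∧
      ∀ n b, b ∈ φ n ↔ ∃ s, b ∈ d s n := by
  obtain ⟨c, hc⟩ := Nat.Partrec.Code.exists_code.1 hφ
  have heval (n : α) (v : ℕ) :
      v ∈ c.eval (Encodable.encode n) ↔ ∃ b ∈ φ n, Encodable.encode b = v := by simp [hc]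
  refine ⟨fun s n => (c.evaln s (Encodable.encode n)).bind Encodable.decode, ?_, ?_, fun n b => ?_⟩
  · exact Primrec.option_bind (Nat.Partrec.Code.primrec_evaln.comp
      (Primrec.pair (Primrec.pair Primrec.fst (Primrec.const c)) (Primrec.encode.comp Primrec.snd)))
      (Primrec.decode.comp Primrec.snd)
  · intro s t n b hst h
    obtain ⟨v, hv, hb⟩ := Option.bind_eq_some_iff.1 h
    exact Option.bind_eq_some_iff.2 ⟨v, Nat.Partrec.Code.evaln_mono hst hv, hb⟩
  · simp only [Option.mem_def, Option.bind_eq_some_iff]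
    constructor
    · intro hb
      obtain ⟨s, hs⟩ := Nat.Partrec.Code.evaln_complete.1 ((heval n _).2 ⟨b, hb, rfl⟩)
      exact ⟨s, _, hs, Encodable.encodek b⟩
    · rintro ⟨s, v, hv, hb⟩
      obtain ⟨b', hb', rfl⟩ := (heval n v).1 (Nat.Partrec.Code.evaln_sound hv)
      rwa [← Option.some_inj.1 ((Encodable.encodek b').symm.trans hb)]

/-- The initial segment `X ↾ k = (X 0, …, X (k - 1))` of a point of Cantor space; it is the string
that determines the first `k` oracle answers. -/
def initSeg (X : ℕ → Bool) (k : ℕ) : List Bool := (List.range k).map X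

@[simp]
theorem length_initSeg (X : ℕ → Bool) (k : ℕ) : (initSeg X k).length = k := by simp [initSeg]

theorem initSeg_take (X : ℕ → Bool) {j k : ℕ} (h : j ≤ k) :
    (initSeg X k).take j = initSeg X j := by
  simp [initSeg, ← List.map_take, List.take_range, h]

theorem initSeg_prefix_initSeg (X : ℕ → Bool) {k l : ℕ} (h : k ≤ l) :
    initSeg X k <+: initSeg X l := by
  rw [← initSeg_take X h]
  exact List.take_prefix _ _

theorem initSeg_getElem? (X : ℕ → Bool) {n k : ℕ} (h : n < k) : (initSeg X k)[n]? = some (X n) := by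
  simp [initSeg, h]

theorem mem_cyl {σ : List Bool} {X : ℕ → Bool} : X ∈ cyl σ ↔ initSeg X σ.length = σ := Iff.rfl

theorem mem_cyl_initSeg {X Y : ℕ → Bool} {k : ℕ} :
    Y ∈ cyl (initSeg X k) ↔ ∀ i < k, Y i = X i := by
  rw [mem_cyl]
  simp [initSeg]

theorem prefix_initSeg_iff {σ : List Bool} {X : ℕ → Bool} {k : ℕ} :
    σ <+: initSeg X k ↔ σ.length ≤ k ∧ X ∈ cyl σ := by
  rw [mem_cyl]
  constructor
  · intro h
    have hk : σ.length ≤ k := by simpa using h.length_le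
    exact ⟨hk, by rw [← initSeg_take X hk, ← List.prefix_iff_eq_take.1 h]⟩
  · rintro ⟨hk, h⟩
    exact h ▸ initSeg_prefix_initSeg X hk

/-- The binary strings of length `n`, listed without repetition: the domain of the finite counts
that decide inequalities between measures of clopen sets. -/
def strings : ℕ → List (List Bool)
  | 0 => [[]]
  | n + 1 => (strings n).flatMap fun l => [false :: l, true :: l]

theorem primrec_strings : Primrec strings := by
  have hstep : Primrec₂ fun (_ : ℕ) (L : List (List Bool)) =>
      L.flatMap fun l => [false :: l, true :: l] :=
    Primrec.list_flatMap Primrec.snd <| Primrec.list_cons.comp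
      (Primrec.list_cons.comp (Primrec.const _) Primrec.snd) <| Primrec.list_cons.comp
      (Primrec.list_cons.comp (Primrec.const _) Primrec.snd) (Primrec.const _)
  refine (Primrec.nat_rec₁ [[]] hstep).of_eq fun n => ?_
  induction n with
  | zero => rfl
  | succ n ih => simp only [strings, ih]

theorem mem_strings {n : ℕ} {l : List Bool} : l ∈ strings n ↔ l.length = n := by
  induction n generalizing l with
  | zero => simp [strings]
  | succ n ih =>
    cases l with
    | nil => simp [strings]
    | cons b l => cases b <;> simp [strings, ih]

theorem nodup_strings (n : ℕ) : (strings n).Nodup := by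
  induction n with
  | zero => simp [strings]
  | succ n ih =>
    rw [strings, List.nodup_flatMap]
    refine ⟨fun l _ => by simp, ih.imp fun h => ?_⟩
    simp [Function.onFun, h.symm]

theorem cyl_eq_pi (σ : List Bool) :
    cyl σ = Set.pi (Finset.range σ.length) fun i => {σ.getD i false} := by
  ext X
  rw [mem_cyl, List.ext_getElem_iff]
  simp +contextual [initSeg]

theorem exists_cyl_initSeg_subset {U : Set (ℕ → Bool)} (hU : IsOpen U) {X : ℕ → Bool}
    (hX : X ∈ U) : ∃ k, cyl (initSeg X k) ⊆ U := by
  obtain ⟨I, u, hu, hsub⟩ := isOpen_pi_iff.1 hU X hX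
  refine ⟨I.sup id + 1, fun Y hY => hsub fun i hi => ?_⟩
  have hlt : i < I.sup id + 1 := Nat.lt_succ_of_le (Finset.le_sup (f := id) hi)
  rw [mem_cyl_initSeg.1 hY i hlt]
  exact (hu i hi).2

theorem measurableSet_cyl (σ : List Bool) : MeasurableSet (cyl σ) := by
  rw [cyl_eq_pi]
  exact MeasurableSet.pi (Finset.countable_toSet _) fun _ _ => measurableSet_singleton _

instance : IsProbabilityMeasure cantorMeasure :=
  inferInstanceAs (IsProbabilityMeasure (Measure.infinitePi _))

theorem cantorMeasure_cyl (σ : List Bool) : cantorMeasure (cyl σ) = (2⁻¹ : ENNReal) ^ σ.length := by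
  rw [cyl_eq_pi, cantorMeasure, Measure.infinitePi_pi _ fun _ _ => measurableSet_singleton _]
  simp

section
variable (p : List Bool → Prop) (k : ℕ)

theorem setOf_initSeg_eq_biUnion_cyl [DecidablePred p] :
    {X | p (initSeg X k)} = ⋃ τ ∈ ((strings k).filter p).toFinset, cyl τ := by
  ext X
  simp only [Set.mem_ofPred_eq, Set.mem_iUnion, List.mem_toFinset, List.mem_filter, mem_strings,
    mem_cyl, decide_eq_true_eq, exists_prop]
  constructor
  · exact fun h => ⟨_, ⟨length_initSeg X k, h⟩, by rw [length_initSeg]⟩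
  · rintro ⟨τ, ⟨rfl, h⟩, hτ⟩
    rwa [hτ]

theorem measurableSet_setOf_initSeg : MeasurableSet {X | p (initSeg X k)} := by
  classical
  rw [setOf_initSeg_eq_biUnion_cyl]
  exact Finset.measurableSet_biUnion _ fun τ _ => measurableSet_cyl τ

theorem measure_setOf_initSeg [DecidablePred p] (μ : Measure (ℕ → Bool)) :
    μ {X | p (initSeg X k)} = ∑ τ ∈ ((strings k).filter p).toFinset, μ (cyl τ) := by
  rw [setOf_initSeg_eq_biUnion_cyl, measure_biUnion_finset _ fun τ _ => measurableSet_cyl τ]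
  intro τ hτ ρ hρ hne
  simp only [List.coe_toFinset, List.mem_filter, mem_strings, Set.mem_ofPred_eq] at hτ hρ
  refine Set.disjoint_left.2 fun X hXτ hXρ => hne ?_
  rw [← mem_cyl.1 hXτ, ← mem_cyl.1 hXρ, hτ.1, hρ.1]

theorem cantorMeasure_setOf_initSeg [DecidablePred p] :
    cantorMeasure {X | p (initSeg X k)} = ((strings k).filter p).length * 2⁻¹ ^ k := by
  have hcyl : ∀ τ ∈ ((strings k).filter p).toFinset, cantorMeasure (cyl τ) = 2⁻¹ ^ k := by
    intro τ hτ
    simp only [List.mem_toFinset, List.mem_filter, mem_strings] at hτ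
    rw [cantorMeasure_cyl, hτ.1]
  rw [measure_setOf_initSeg, Finset.sum_congr rfl hcyl, Finset.sum_const,
    List.toFinset_card_of_nodup ((nodup_strings k).filter _), nsmul_eq_mul]

theorem cantorMeasure_cyl_div_three_lt_iff [DecidablePred p] (σ : List Bool) :
    cantorMeasure (cyl σ) / 3 < cantorMeasure {X | p (initSeg X k)} ↔
      2 ^ k < 3 * 2 ^ σ.length * ((strings k).filter p).length := by
  have hclear (N : ℝ) : 2⁻¹ ^ σ.length / 3 < N * 2⁻¹ ^ k ↔ 2 ^ k < 3 * 2 ^ σ.length * N := by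
    rw [inv_pow, inv_pow, ← div_eq_mul_inv, inv_eq_one_div, div_div,
      div_lt_div_iff₀ (by positivity) (by positivity), one_mul, mul_comm N, mul_comm (2 ^ _) 3]
  rw [cantorMeasure_setOf_initSeg, cantorMeasure_cyl, ← ENNReal.toReal_lt_toReal (by finiteness)
    (by finiteness)]
  simp only [ENNReal.toReal_mul, ENNReal.toReal_div, ENNReal.toReal_pow, ENNReal.toReal_inv,
    ENNReal.toReal_ofNat, ENNReal.toReal_natCast]
  rw [hclear]
  exact_mod_cast Iff.rfl

end

theorem exists_mul_measure_cyl_lt {μ : Measure (ℕ → Bool)} [IsFiniteMeasure μ]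
    {P : Set (ℕ → Bool)} (hP : μ P ≠ 0) {c : ENNReal} (hc : c < 1) :
    ∃ σ, c * μ (cyl σ) < μ (P ∩ cyl σ) := by
  classical
  have hcP : c * μ P < μ P := by
    simpa using ENNReal.mul_lt_mul_left hP (measure_ne_top μ P) hc
  obtain ⟨U, hPU, hU, hcU⟩ := Set.exists_isOpen_lt_of_lt P (μ P / c)
    ((ENNReal.lt_div_iff_mul_lt (.inr (measure_ne_top μ P)) (.inr hP)).2 (by rwa [mul_comm]))
  let V (k : ℕ) : Set (ℕ → Bool) := {X | cyl (initSeg X k) ⊆ U}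
  have hVU (k : ℕ) : V k ⊆ U := fun X hX => hX (mem_cyl_initSeg.2 fun _ _ => rfl)
  have hVmono : Monotone fun k => P ∩ V k := fun k l hkl X hX =>
    ⟨hX.1, fun Y hY => hX.2 (mem_cyl_initSeg.2 fun i hi =>
      mem_cyl_initSeg.1 hY i (hi.trans_le hkl))⟩
  have hPV : ⋃ k, P ∩ V k = P := by
    rw [← Set.inter_iUnion, Set.inter_eq_left]
    exact fun X hX => Set.mem_iUnion.2 (exists_cyl_initSeg_subset hU (hPU hX))
  obtain ⟨k, hk⟩ : ∃ k, c * μ U < μ (P ∩ V k) := by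
    rw [← lt_iSup_iff, ← hVmono.measure_iUnion, hPV, mul_comm]
    exact ENNReal.mul_lt_of_lt_div hcU
  have hsum : ∑ τ ∈ ((strings k).filter (cyl · ⊆ U)).toFinset, c * μ (cyl τ) <
      ∑ τ ∈ ((strings k).filter (cyl · ⊆ U)).toFinset, μ.restrict P (cyl τ) := by
    rw [← Finset.mul_sum, ← measure_setOf_initSeg, ← measure_setOf_initSeg,
      Measure.restrict_apply (measurableSet_setOf_initSeg (cyl · ⊆ U) k), Set.inter_comm]
    exact (mul_le_mul_right (measure_mono (hVU k)) c).trans_lt hk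
  obtain ⟨σ, -, hσ⟩ := Finset.exists_lt_of_sum_lt hsum
  exact ⟨σ, by rwa [Measure.restrict_apply (measurableSet_cyl σ), Set.inter_comm] at hσ⟩

/-- `Ψ` is a Turing functional, uniformly partial computable in its oracle: a computation reads only
a finite initial segment of the oracle, and `F` runs it on such segments. Coherence of `F` along
initial segments of `X` is enforced only through single-valuedness of `Ψ X n`. -/
def IsTuringFunctional {α β : Type*} [Primcodable α] [Primcodable β]
    (Ψ : (ℕ → Bool) → α →. β) : Prop :=
  ∃ F : List Bool → α →. β, Partrec₂ F ∧ ∀ X n b, b ∈ Ψ X n ↔ ∃ k, b ∈ F (initSeg X k) n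

theorem IsTuringFunctional.exists_primrecRel {α β : Type*} [Primcodable α] [Primcodable β]
    {Ψ : (ℕ → Bool) → α →. β} (hΨ : IsTuringFunctional Ψ) :
    ∃ R : List Bool → α × β → Prop, PrimrecRel R ∧ (∀ {σ τ p}, σ <+: τ → R σ p → R τ p) ∧
      ∀ X n b, b ∈ Ψ X n ↔ ∃ k, R (initSeg X k) (n, b) := by
  obtain ⟨F, hF, hΨF⟩ := hΨ
  obtain ⟨d, hd, hmono, hdF⟩ := exists_primrec_stages hF
  refine ⟨fun σ p => ∃ j < σ.length + 1, p.2 ∈ d σ.length (σ.take j, p.1), ?_, ?_, ?_⟩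
  · have hmem : PrimrecRel fun (j : ℕ) (q : List Bool × α × β) =>
        q.2.2 ∈ d q.1.length (q.1.take j, q.2.1) :=
      Primrec.eq.comp (hd.comp (Primrec.list_length.comp (Primrec.fst.comp Primrec.snd))
        (Primrec.pair (Primrec.list_take.comp Primrec.fst (Primrec.fst.comp Primrec.snd))
          (Primrec.fst.comp (Primrec.snd.comp Primrec.snd))))
        (Primrec.option_some.comp (Primrec.snd.comp (Primrec.snd.comp Primrec.snd)))
    have hbdd := hmem.exists_mem_list
    exact (hbdd.comp (Primrec.list_range.comp (Primrec.succ.comp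
      (Primrec.list_length.comp Primrec.fst))) Primrec.id).of_eq fun p => by simp
  · rintro σ _ p ⟨ρ, rfl⟩ ⟨j, hj, h⟩
    rw [← List.take_append_of_le_length (l₂ := ρ) (Nat.le_of_lt_succ hj)] at h
    rw [List.length_append]
    exact ⟨j, by lia, hmono (Nat.le_add_right _ _) h⟩
  · intro X n b
    rw [hΨF]
    constructor
    · rintro ⟨k, hk⟩
      obtain ⟨s, hs⟩ := (hdF (_, _) b).1 hk
      refine ⟨max k s, k, by simp, ?_⟩
      rw [length_initSeg, initSeg_take X (le_max_left k s)]
      exact hmono (le_max_right k s) hs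
    · rintro ⟨k, j, hj, h⟩
      rw [length_initSeg] at hj
      rw [initSeg_take X (Nat.le_of_lt_succ hj)] at h
      exact ⟨j, (hdF (_, _) b).2 ⟨_, h⟩⟩

section
open OmegaCompletePartialOrder

theorem ωScottContinuous_part_iff {α β : Type*} [OmegaCompletePartialOrder α] {f : α → Part β} :
    ωScottContinuous f ↔ ∀ (c : Chain α) (b : β), b ∈ f (ωSup c) ↔ ∃ k, b ∈ f (c k) := by
  have hmem (hf : Monotone f) (c : Chain α) (b : β) :
      b ∈ ωSup (c.map ⟨f, hf⟩) ↔ ∃ k, b ∈ f (c k) := by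
    rw [Part.mem_ωSup]
    exact exists_congr fun k => eq_comm.trans Part.eq_some_iff
  refine ⟨fun hf c b => by rw [hf.map_ωSup, hmem], fun h => ?_⟩
  have hmono : Monotone f := by
    intro x y hxy b hb
    have hsup : ωSup (Chain.pair x y hxy) = y :=
      le_antisymm (ωSup_le _ _ fun i => by cases i <;> simp [hxy])
        (le_ωSup (Chain.pair x y hxy) 1)
    rw [← hsup, h]
    exact ⟨0, hb⟩
  exact .of_monotone_map_ωSup ⟨hmono, fun c => Part.ext fun b => by rw [h, hmem]⟩

theorem ωScottContinuous_rfind {α : Type*} [OmegaCompletePartialOrder α] {p : α → ℕ → Part Bool}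
    (hp : ωScottContinuous p) : ωScottContinuous fun x => Nat.rfind (p x) := by
  have hmem (c : Chain α) (n : ℕ) (b : Bool) : b ∈ p (ωSup c) n ↔ ∃ k, b ∈ p (c k) n :=
    ωScottContinuous_part_iff.1 (ωScottContinuous.apply₂ hp n) c b
  have hmono (c : Chain α) (n : ℕ) (b : Bool) {j k : ℕ} (h : j ≤ k) (hj : b ∈ p (c j) n) :
      b ∈ p (c k) n := hp.monotone (c.monotone h) n b hj
  refine ωScottContinuous_part_iff.2 fun c m => ?_
  refine Nat.mem_rfind.trans (Iff.trans ?_ (exists_congr fun _ => Nat.mem_rfind).symm)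
  simp only [hmem]
  constructor
  · rintro ⟨⟨j, hj⟩, hlt⟩
    choose! i hi using fun l (hl : l < m) => hlt hl
    refine ⟨(Finset.range m).sup i ⊔ j, hmono c m _ le_sup_right hj, fun {l} hl => ?_⟩
    exact hmono c l _ (le_sup_of_le_left (Finset.le_sup (Finset.mem_range.2 hl))) (hi l hl)
  · rintro ⟨k, hk, hlt⟩
    exact ⟨⟨k, hk⟩, fun hl => ⟨k, hlt hl⟩⟩

/-- A recursive operator on partial functions: it is continuous (a value of `Φ g` depends on
finitely many values of `g`) and partial computable uniformly in its argument. -/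
structure IsRecursiveOperator (Φ : (ℕ → Part ℕ) → ℕ → Part ℕ) : Prop where
  continuous : ωScottContinuous Φ
  partrec₂ {α : Type} [Primcodable α] {g : α → ℕ → Part ℕ} (hg : Partrec₂ g) :
    Partrec₂ fun a => Φ (g a)

namespace IsRecursiveOperator

variable {Φ Θ : (ℕ → Part ℕ) → ℕ → Part ℕ}

theorem const {f : ℕ → Part ℕ} (hf : Nat.Partrec f) : IsRecursiveOperator fun _ => f :=
  ⟨ωScottContinuous.const, fun _ => (Partrec.nat_iff.2 hf).comp Computable.snd⟩

theorem id : IsRecursiveOperator id := ⟨ωScottContinuous.id, fun hg => hg⟩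

theorem pair (hΦ : IsRecursiveOperator Φ) (hΘ : IsRecursiveOperator Θ) :
    IsRecursiveOperator fun g n => Nat.pair <$> Φ g n <*> Θ g n where
  continuous := .of_apply₂ fun n =>
    ContinuousHom.ωScottContinuous.seq (ContinuousHom.ωScottContinuous.map (hΦ.continuous.apply₂ n))
      (hΘ.continuous.apply₂ n)
  partrec₂ {α _ g} hg := by
    have hpair : Partrec₂ fun (q : α × ℕ) (v : ℕ) => (Θ (g q.1) q.2).map (Nat.pair v) :=
      Partrec.map ((hΘ.partrec₂ hg).comp (Computable.fst.comp Computable.fst)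
        (Computable.snd.comp Computable.fst))
        (Primrec₂.natPair.to_comp.comp (Computable.snd.comp Computable.fst) Computable.snd).to₂
    refine ((hΦ.partrec₂ hg).bind hpair).of_eq fun q => ?_
    simp [seq_eq_bind_map]

theorem comp (hΦ : IsRecursiveOperator Φ) (hΘ : IsRecursiveOperator Θ) :
    IsRecursiveOperator fun g n => Θ g n >>= Φ g where
  continuous := .of_apply₂ fun n =>
    ContinuousHom.ωScottContinuous.bind (hΘ.continuous.apply₂ n) hΦ.continuous
  partrec₂ hg := (hΘ.partrec₂ hg).bind
    ((hΦ.partrec₂ hg).comp (Computable.fst.comp Computable.fst) Computable.snd)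

theorem prec (hΦ : IsRecursiveOperator Φ) (hΘ : IsRecursiveOperator Θ) :
    IsRecursiveOperator fun g p =>
      let (a, n) := Nat.unpair p
      n.rec (Φ g a) fun y IH => do
        let i ← IH
        Θ g (Nat.pair a (Nat.pair y i)) where
  continuous := by
    refine .of_apply₂ fun p => ?_
    dsimp only
    induction p.unpair.2 with
    | zero => exact hΦ.continuous.apply₂ _
    | succ n ih =>
      exact ContinuousHom.ωScottContinuous.bind ih
        (.of_apply₂ fun i => hΘ.continuous.apply₂ _)
  partrec₂ {α _ g} hg := by
    have hunpair : Computable fun q : α × ℕ => q.2.unpair := Computable.unpair.comp Computable.snd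
    have hstep : Partrec₂ fun (q : α × ℕ) (r : ℕ × ℕ) =>
        Θ (g q.1) (Nat.pair q.2.unpair.1 (Nat.pair r.1 r.2)) :=
      (hΘ.partrec₂ hg).comp (Computable.fst.comp Computable.fst)
        (Primrec₂.natPair.to_comp.comp (Computable.fst.comp (hunpair.comp Computable.fst))
          (Primrec₂.natPair.to_comp.comp (Computable.fst.comp Computable.snd)
            (Computable.snd.comp Computable.snd)))
    exact Partrec.nat_rec (Computable.snd.comp hunpair)
      ((hΦ.partrec₂ hg).comp Computable.fst (Computable.fst.comp hunpair)) hstep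

theorem rfind (hΦ : IsRecursiveOperator Φ) :
    IsRecursiveOperator fun g a => Nat.rfind fun n => (fun m => m = 0) <$> Φ g (Nat.pair a n) where
  continuous := .of_apply₂ fun a => ωScottContinuous_rfind <| .of_apply₂ fun n =>
    ContinuousHom.ωScottContinuous.map (hΦ.continuous.apply₂ _)
  partrec₂ {α _ g} hg := by
    have hΦ' : Partrec₂ fun (q : α × ℕ) (n : ℕ) => Φ (g q.1) (Nat.pair q.2 n) :=
      (hΦ.partrec₂ hg).comp (Computable.fst.comp Computable.fst)
        (Primrec₂.natPair.to_comp.comp (Computable.snd.comp Computable.fst) Computable.snd)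
    have hzero : Computable fun m : ℕ => decide (m = 0) :=
      (Primrec.eq.comp Primrec.id (Primrec.const 0)).decide.to_comp
    exact Partrec.rfind (hΦ'.map (hzero.comp Computable.snd).to₂)

theorem exists_of_recursiveIn {g f : ℕ →. ℕ} (h : Nat.RecursiveIn {g} f) :
    ∃ Φ, IsRecursiveOperator Φ ∧ Φ g = f := by
  induction h with
  | zero => exact ⟨_, .const .zero, rfl⟩
  | succ => exact ⟨_, .const .succ, rfl⟩
  | left => exact ⟨_, .const .left, rfl⟩
  | right => exact ⟨_, .const .right, rfl⟩
  | oracle g hg => exact ⟨_, .id, hg.symm⟩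
  | pair _ _ ihf ihh =>
    obtain ⟨Φ, hΦ, rfl⟩ := ihf
    obtain ⟨Θ, hΘ, rfl⟩ := ihh
    exact ⟨_, hΦ.pair hΘ, rfl⟩
  | comp _ _ ihf ihh =>
    obtain ⟨Φ, hΦ, rfl⟩ := ihf
    obtain ⟨Θ, hΘ, rfl⟩ := ihh
    exact ⟨_, hΦ.comp hΘ, rfl⟩
  | prec _ _ ihf ihh =>
    obtain ⟨Φ, hΦ, rfl⟩ := ihf
    obtain ⟨Θ, hΘ, rfl⟩ := ihh
    exact ⟨_, hΦ.prec hΘ, rfl⟩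
  | rfind _ ihf =>
    obtain ⟨Φ, hΦ, rfl⟩ := ihf
    exact ⟨_, hΦ.rfind, rfl⟩

end IsRecursiveOperator
end

open OmegaCompletePartialOrder in
theorem IsRecursiveOperator.isTuringFunctional {Φ : (ℕ → Part ℕ) → ℕ → Part ℕ}
    (hΦ : IsRecursiveOperator Φ) :
    IsTuringFunctional fun X : ℕ → Bool => Φ fun n => Part.some (X n).toNat := by
  let oracle (σ : List Bool) (n : ℕ) : Part ℕ := ((σ[n]?.map Bool.toNat : Option ℕ) : Part ℕ)
  have horacle : Partrec₂ oracle :=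
    Computable.ofOption (Primrec.option_map Primrec.list_getElem?
      ((Primrec.dom_finite Bool.toNat).comp Primrec.snd).to₂).to_comp
  refine ⟨fun σ => Φ (oracle σ), hΦ.partrec₂ horacle, fun X n b => ?_⟩
  have hmem (k m v : ℕ) : v ∈ oracle (initSeg X k) m ↔ m < k ∧ v = (X m).toNat := by
    by_cases hm : m < k <;> simp [oracle, initSeg, hm]
  let c : Chain (ℕ → Part ℕ) := ⟨fun k => oracle (initSeg X k), fun k l hkl m v hv =>
    (hmem l m v).2 (((hmem k m v).1 hv).imp_left fun h => h.trans_le hkl)⟩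
  have hc : ωSup c = fun n => Part.some (X n).toNat := by
    refine funext fun m => Part.ext fun v => ?_
    refine (ωScottContinuous_part_iff.1 (.apply m) c v).trans ?_
    rw [Part.mem_some_iff]
    exact ⟨fun ⟨k, hk⟩ => ((hmem k m v).1 hk).2,
      fun hv => ⟨m + 1, (hmem (m + 1) m v).2 ⟨m.lt_succ_self, hv⟩⟩⟩
  beta_reduce
  rw [← hc]
  exact ωScottContinuous_part_iff.1 (hΦ.continuous.apply₂ n) c b

theorem IsTuringFunctional.map {α β γ : Type*} [Primcodable α] [Primcodable β] [Primcodable γ]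
    {Ψ : (ℕ → Bool) → α →. β} (hΨ : IsTuringFunctional Ψ) {f : β → γ} (hf : Computable f) :
    IsTuringFunctional fun X n => (Ψ X n).map f := by
  obtain ⟨F, hF, hΨF⟩ := hΨ
  refine ⟨fun σ n => (F σ n).map f, Partrec.map hF (hf.comp Computable.snd).to₂, fun X n b => ?_⟩
  simp only [Part.mem_map_iff, hΨF]
  constructor
  · rintro ⟨a, ⟨k, hk⟩, rfl⟩
    exact ⟨k, a, hk, rfl⟩
  · rintro ⟨k, a, hk, rfl⟩
    exact ⟨a, ⟨k, hk⟩, rfl⟩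

theorem SetTuringReducible.exists_isTuringFunctional {A B : Set ℕ} (h : SetTuringReducible B A) :
    ∃ Ψ : (ℕ → Bool) → ℕ →. Bool, IsTuringFunctional Ψ ∧
      ∀ n, Ψ (charSeq A) n = Part.some (charSeq B n) := by
  obtain ⟨Φ, hΦ, hΦB⟩ := IsRecursiveOperator.exists_of_recursiveIn (RecursiveIn.iff_nat.1 h)
  have hisOne : Computable fun v : ℕ => decide (v = 1) :=
    (Primrec.eq.comp Primrec.id (Primrec.const 1)).decide.to_comp
  refine ⟨_, hΦ.isTuringFunctional.map hisOne, fun n => ?_⟩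
  have hval : Φ (charFun A) n = Part.some (charSeq B n).toNat := congrFun hΦB n
  change (Φ (charFun A) n).map _ = _
  rw [hval, Part.map_some]
  cases charSeq B n <;> rfl

theorem isTuringFunctional_truthTable {f : ℕ → TruthTable} (hf : Computable f) :
    IsTuringFunctional fun (X : ℕ → Bool) (n : ℕ) =>
      Part.some (decide ((f n).1.map X ∈ (f n).2)) := by
  let eval (σ : List Bool) (t : TruthTable) : Option Bool :=
    if ∀ q ∈ t.1, q < σ.length then some (decide (t.1.map (σ.getD · false) ∈ t.2)) else none
  have heval : Primrec₂ eval := by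
    have hqueries : PrimrecRel fun (L : List ℕ) (σ : List Bool) => ∀ q ∈ L, q < σ.length :=
      PrimrecRel.forall_mem_list (Primrec.nat_lt.comp Primrec.fst
        (Primrec.list_length.comp Primrec.snd))
    have hmem : PrimrecRel fun (L : List (List Bool)) (τ : List Bool) => τ ∈ L :=
      Primrec.eq.exists_mem_list.of_eq fun L τ => by simp
    have hanswers : Primrec₂ fun (σ : List Bool) (t : TruthTable) => t.1.map (σ.getD · false) :=
      Primrec.list_map (Primrec.fst.comp Primrec.snd)
        ((Primrec.list_getD false).comp (Primrec.fst.comp Primrec.fst) Primrec.snd).to₂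
    exact Primrec.ite (hqueries.comp (Primrec.fst.comp Primrec.snd) Primrec.fst)
      (Primrec.option_some.comp (hmem.comp (Primrec.snd.comp Primrec.snd) hanswers).decide)
      (Primrec.const none)
  have heval_iff (X : ℕ → Bool) (k : ℕ) (t : TruthTable) (b : Bool) :
      b ∈ eval (initSeg X k) t ↔ (∀ q ∈ t.1, q < k) ∧ b = decide (t.1.map X ∈ t.2) := by
    by_cases hk : ∀ q ∈ t.1, q < k
    · have hanswers : t.1.map ((initSeg X k).getD · false) = t.1.map X :=
        List.map_congr_left fun q hq => by simp [List.getD, initSeg_getElem? X (hk q hq)]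
      simp only [eval, length_initSeg, if_pos hk, hanswers, Option.mem_some_iff]
      exact ⟨fun h => ⟨hk, h.symm⟩, fun h => h.2.symm⟩
    · simp [eval, hk]
  refine ⟨fun σ n => eval σ (f n), Computable.ofOption
    (heval.to_comp.comp Computable.fst (hf.comp Computable.snd)), fun X n b => ?_⟩
  simp only [Part.mem_some_iff, Part.mem_coe, heval_iff, exists_and_right]
  refine (and_iff_right ⟨(f n).1.sum + 1, fun q hq => ?_⟩).symm
  exact Nat.lt_succ_of_le (List.le_sum_of_mem hq)

theorem exists_lt_measure_of_subset_iUnion {Ω ι : Type*} [MeasurableSpace Ω] {μ : Measure Ω}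
    [Fintype ι] {E : ι → ℕ → Set Ω} (hE : ∀ i, Monotone (E i)) {P : Set Ω}
    (hP : P ⊆ ⋃ i, ⋃ k, E i k) {c : ENNReal} (hc : Fintype.card ι * c < μ P) :
    ∃ i k, c < μ (E i k) := by
  by_contra! hle
  have hunion (i : ι) : μ (⋃ k, E i k) ≤ c := by
    rw [(hE i).measure_iUnion]
    exact iSup_le (hle i)
  refine hc.not_ge ?_
  calc μ P ≤ μ (⋃ i, ⋃ k, E i k) := measure_mono hP
    _ ≤ ∑ i, μ (⋃ k, E i k) := measure_iUnion_fintype_le μ _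
    _ ≤ ∑ _i : ι, c := Finset.sum_le_sum fun i _ => hunion i
    _ = Fintype.card ι * c := by simp

theorem primrecRel_cantorMeasure_cyl_div_three_lt {α : Type*} [Primcodable α]
    {R : List Bool → α → Prop} (hR : PrimrecRel R) (σ : List Bool) :
    PrimrecRel fun a k => cantorMeasure (cyl σ) / 3 < cantorMeasure {X | R (initSeg X k) a} := by
  classical
  have hpow : Primrec₂ fun m n : ℕ => m ^ n := Primrec₂.unpaired'.1 Nat.Primrec.pow
  have hcount : Primrec₂ fun (a : α) (k : ℕ) => ((strings k).filter (R · a)).length :=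
    Primrec.list_length.comp
      (hR.listFilter.comp (primrec_strings.comp Primrec.snd) Primrec.fst)
  exact (Primrec.nat_lt.comp (hpow.comp (Primrec.const 2) Primrec.snd)
    (Primrec.nat_mul.comp (Primrec.const (3 * 2 ^ σ.length)) hcount)).of_eq
    fun q => (cantorMeasure_cyl_div_three_lt_iff (R · q.1) q.2 σ).symm

theorem primrecRel_isPrefix {α : Type*} [Primcodable α] :
    PrimrecRel fun l₁ l₂ : List α => l₁ <+: l₂ :=
  (Primrec.eq.comp Primrec.fst
    (Primrec.list_take.comp (Primrec.list_length.comp Primrec.fst) Primrec.snd)).of_eq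
    fun _ => List.prefix_iff_eq_take.symm

theorem IsTuringFunctional.exists_computable_selection {Ψ : (ℕ → Bool) → ℕ →. Bool}
    (hΨ : IsTuringFunctional Ψ) {P : Set (ℕ → Bool)} (hP : cantorMeasure P ≠ 0)
    (htot : ∀ X ∈ P, ∀ n, (Ψ X n).Dom) :
    ∃ C : ℕ → Bool, Computable C ∧ ∀ n, ∃ X ∈ P, C n ∈ Ψ X n := by
  obtain ⟨R, hR, hmono, hΨR⟩ := hΨ.exists_primrecRel
  obtain ⟨σ, hσ⟩ : ∃ σ, 2 * (cantorMeasure (cyl σ) / 3) < cantorMeasure (P ∩ cyl σ) := by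
    simpa only [ENNReal.mul_comm_div] using exists_mul_measure_cyl_lt hP (c := 2 / 3)
      (ENNReal.div_lt_of_lt_mul (by norm_num))
  let S (τ : List Bool) (p : ℕ × Bool) : Prop := σ <+: τ ∧ R τ p
  let D (p : ℕ × Bool) (k : ℕ) : Set (ℕ → Bool) := {X | S (initSeg X k) p}
  have hS : PrimrecRel S := (primrecRel_isPrefix.comp (Primrec.const σ) Primrec.fst).and hR
  have hD (p : ℕ × Bool) : Monotone (D p) := fun k l hkl X hX =>
    ⟨hX.1.trans (initSeg_prefix_initSeg X hkl), hmono (initSeg_prefix_initSeg X hkl) hX.2⟩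
  have hcover (n : ℕ) : P ∩ cyl σ ⊆ ⋃ b, ⋃ k, D (n, b) k := by
    rintro X ⟨hXP, hXσ⟩
    obtain ⟨b, hb⟩ := Part.dom_iff_mem.1 (htot X hXP n)
    obtain ⟨k, hk⟩ := (hΨR X n b).1 hb
    exact Set.mem_iUnion₂.2 ⟨b, max σ.length k, prefix_initSeg_iff.2 ⟨le_max_left _ _, hXσ⟩,
      hmono (initSeg_prefix_initSeg X (le_max_right _ _)) hk⟩
  have hex (n : ℕ) : ∃ q : Bool × ℕ, cantorMeasure (cyl σ) / 3 < cantorMeasure (D (n, q.1) q.2) :=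
    Prod.exists.2 <| exists_lt_measure_of_subset_iUnion (fun b => hD (n, b)) (hcover n)
      (by simpa using hσ)
  have hsearch : PrimrecPred fun p : ℕ × Bool × ℕ =>
      cantorMeasure (cyl σ) / 3 < cantorMeasure (D (p.1, p.2.1) p.2.2) :=
    (primrecRel_cantorMeasure_cyl_div_three_lt hS σ).comp
      (Primrec.pair Primrec.fst (Primrec.fst.comp Primrec.snd)) (Primrec.snd.comp Primrec.snd)
  obtain ⟨f, hf, hfD⟩ := exists_computable_choice hsearch.computablePred hex
  refine ⟨fun n => (f n).1, Computable.fst.comp hf, fun n => ?_⟩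
  obtain ⟨X, ⟨hXP, -⟩, hXD⟩ : ((P ∩ cyl σ) ∩ D (n, (f n).1) (f n).2).Nonempty := by
    refine nonempty_inter_of_measure_lt_add cantorMeasure (u := cyl σ)
      (measurableSet_setOf_initSeg (S · (n, (f n).1)) (f n).2) Set.inter_subset_right
      (fun X hX => (prefix_initSeg_iff.1 hX.1).2) ?_
    rw [← ENNReal.add_thirds (cantorMeasure (cyl σ)), ← two_mul]
    exact ENNReal.add_lt_add hσ (hfD n)
  exact ⟨X, hXP, (hΨR X n _).2 ⟨_, hXD.2⟩⟩

theorem UniformlySigma.comp {n : ℕ} {U : ℕ → Set (ℕ → Bool)} (hU : UniformlySigma n U) {f : ℕ → ℕ}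
    (hf : Computable f) : UniformlySigma n (U ∘ f) := by
  induction n generalizing U f with
  | zero =>
    obtain ⟨F, hF, hUF⟩ := hU
    exact ⟨F ∘ f, hF.comp hf, fun k => hUF (f k)⟩
  | succ n ih =>
    obtain ⟨V, hV, hUV⟩ := hU
    have hpair : Computable fun m : ℕ => Nat.pair (f m.unpair.1) m.unpair.2 :=
      Primrec₂.natPair.to_comp.comp (hf.comp (Computable.fst.comp Computable.unpair))
        (Computable.snd.comp Computable.unpair)
    exact ⟨_, ih hV hpair, fun k => by simp [hUV]⟩

theorem UniformlySigma.isPiClass_iInter {n : ℕ} {U : ℕ → Set (ℕ → Bool)}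
    (hU : UniformlySigma n U) : IsPiClass (n + 1) (⋂ i, U i) :=
  ⟨_, ⟨_, hU.comp (Computable.snd.comp Computable.unpair), fun _ => rfl⟩, by
    simp [Set.compl_iInter]⟩

theorem uniformlySigma_zero_setOf_initSeg {S : List Bool → ℕ → Prop} (hS : PrimrecRel S)
    {ℓ : ℕ → ℕ} (hℓ : Primrec ℓ) : UniformlySigma 0 fun m => {X | S (initSeg X (ℓ m)) m} := by
  classical
  refine ⟨fun m => (strings (ℓ m)).filter (S · m),
    (hS.listFilter.comp (primrec_strings.comp hℓ) Primrec.id).to_comp, fun m => ?_⟩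
  exact (setOf_initSeg_eq_biUnion_cyl (S · m) (ℓ m)).trans (by simp only [List.mem_toFinset])

theorem uniformlySigma_one_setOf_exists_initSeg {S : List Bool → ℕ → Prop} (hS : PrimrecRel S) :
    UniformlySigma 1 fun i => {X | ∃ k, S (initSeg X k) i} := by
  have hS' : PrimrecRel fun σ (m : ℕ) => ¬S σ m.unpair.1 :=
    (hS.comp Primrec.fst (Primrec.fst.comp (Primrec.unpair.comp Primrec.snd))).not
  refine ⟨_, uniformlySigma_zero_setOf_initSeg hS' (Primrec.snd.comp Primrec.unpair), fun i => ?_⟩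
  ext X
  simp

section
variable {α : Type*} [Primcodable α] {S : List Bool → α → Prop}

theorem primrecRel_forall_mem_decode (hS : PrimrecRel S) :
    PrimrecRel fun σ i => ∀ a ∈ (Encodable.decode i : Option α), S σ a := by
  have hswap : PrimrecRel fun a σ => S σ a := hS.comp Primrec.snd Primrec.fst
  exact (hswap.forall_mem_list.comp
    (Primrec.optionToList.comp (Primrec.decode.comp Primrec.snd)) Primrec.fst).of_eq
    fun p => by simp

theorem isPiClass_one_setOf_forall (hS : PrimrecRel S) :
    IsPiClass 1 {X | ∀ a k, S (initSeg X k) a} := by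
  have hS' : PrimrecRel fun σ (m : ℕ) =>
      ∀ a ∈ (Encodable.decode m.unpair.1 : Option α), S σ a :=
    (primrecRel_forall_mem_decode hS).comp Primrec.fst
      (Primrec.fst.comp (Primrec.unpair.comp Primrec.snd))
  convert (uniformlySigma_zero_setOf_initSeg hS'
    (Primrec.snd.comp Primrec.unpair)).isPiClass_iInter
  ext X
  simp only [Set.mem_ofPred_eq, Set.mem_iInter]
  constructor
  · exact fun h m a _ => h a _
  · exact fun h a k => by simpa using h (Nat.pair (Encodable.encode a) k)

theorem isPiClass_two_setOf_forall_exists (hS : PrimrecRel S) :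
    IsPiClass 2 {X | ∀ a, ∃ k, S (initSeg X k) a} := by
  convert (uniformlySigma_one_setOf_exists_initSeg
    (primrecRel_forall_mem_decode hS)).isPiClass_iInter
  ext X
  simp only [Set.mem_ofPred_eq, Set.mem_iInter]
  constructor
  · intro h i
    cases hi : (Encodable.decode i : Option α) with
    | none => simp
    | some a => simpa using h a
  · exact fun h a => by simpa using h (Encodable.encode a)

end

theorem IsTuringFunctional.isPiClass_one_setOf_extends {α β : Type*} [Primcodable α]
    [Primcodable β] {Ψ : (ℕ → Bool) → α →. β} (hΨ : IsTuringFunctional Ψ)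
    (htot : ∀ X n, (Ψ X n).Dom) {φ : α →. β} (hφ : Partrec φ) :
    IsPiClass 1 {X | ∀ n, ∀ b ∈ φ n, b ∈ Ψ X n} := by
  obtain ⟨R, hR, -, hΨR⟩ := hΨ.exists_primrecRel
  obtain ⟨d, hd, -, hdφ⟩ := exists_primrec_stages hφ
  let S (σ : List Bool) (p : (ℕ × α) × β × β) : Prop :=
    p.2.1 ∉ d p.1.1 p.1.2 ∨ ¬R σ (p.1.2, p.2.2) ∨ p.2.2 = p.2.1
  have hS : PrimrecRel S := by
    have hn : Primrec fun q : List Bool × (ℕ × α) × β × β => q.2.1.2 :=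
      Primrec.snd.comp (Primrec.fst.comp Primrec.snd)
    have hb : Primrec fun q : List Bool × (ℕ × α) × β × β => q.2.2.1 :=
      Primrec.fst.comp (Primrec.snd.comp Primrec.snd)
    have hc : Primrec fun q : List Bool × (ℕ × α) × β × β => q.2.2.2 :=
      Primrec.snd.comp (Primrec.snd.comp Primrec.snd)
    exact (Primrec.eq.comp (hd.comp (Primrec.fst.comp (Primrec.fst.comp Primrec.snd)) hn)
      (Primrec.option_some.comp hb)).not.or
      ((hR.comp Primrec.fst (Primrec.pair hn hc)).not.or (Primrec.eq.comp hc hb))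
  convert isPiClass_one_setOf_forall hS using 3 with X
  constructor
  · rintro h ⟨⟨s, n⟩, b, c⟩ k
    simp only [S, or_iff_not_imp_left, not_not]
    exact fun hb hc => Part.mem_unique ((hΨR X n c).2 ⟨k, hc⟩) (h n b ((hdφ n b).2 ⟨s, hb⟩))
  · intro h n b hb
    obtain ⟨s, hs⟩ := (hdφ n b).1 hb
    obtain ⟨c, hc⟩ := Part.dom_iff_mem.1 (htot X n)
    obtain ⟨k, hk⟩ := (hΨR X n c).1 hc
    have hcb : c = b := by simpa [S, Option.mem_def.1 hs, hk] using h ((s, n), b, c) k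
    exact hcb ▸ hc

theorem IsTuringFunctional.isPiClass_two_setOf_total_extends {α : Type*} [Primcodable α]
    {Ψ : (ℕ → Bool) → α →. Bool} (hΨ : IsTuringFunctional Ψ) {φ : α →. Bool} (hφ : Partrec φ) :
    IsPiClass 2 {X | ∀ n, (Ψ X n).Dom ∧ ∀ b ∈ φ n, b ∈ Ψ X n} := by
  obtain ⟨R, hR, -, hΨR⟩ := hΨ.exists_primrecRel
  obtain ⟨d, hd, -, hdφ⟩ := exists_primrec_stages hφ
  -- `o.getD b = b` says that `o` is empty or has the value `b`.
  let S (σ : List Bool) (p : ℕ × α) : Prop :=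
    ∃ b ∈ [false, true], R σ (p.2, b) ∧ (d p.1 p.2).getD b = b
  have hS : PrimrecRel S := by
    have hmatrix : PrimrecRel fun (b : Bool) (q : List Bool × ℕ × α) =>
        R q.1 (q.2.2, b) ∧ (d q.2.1 q.2.2).getD b = b := by
      have hn : Primrec fun q : Bool × List Bool × ℕ × α => q.2.2.2 :=
        Primrec.snd.comp (Primrec.snd.comp Primrec.snd)
      exact (hR.comp (Primrec.fst.comp Primrec.snd) (Primrec.pair hn Primrec.fst)).and
        (Primrec.eq.comp (Primrec.option_getD.comp
          (hd.comp (Primrec.fst.comp (Primrec.snd.comp Primrec.snd)) hn) Primrec.fst) Primrec.fst)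
    exact hmatrix.exists_mem_list.comp (Primrec.const _) Primrec.id
  convert isPiClass_two_setOf_forall_exists hS using 3 with X
  constructor
  · rintro h ⟨s, n⟩
    obtain ⟨b, hb⟩ := Part.dom_iff_mem.1 (h n).1
    obtain ⟨k, hk⟩ := (hΨR X n b).1 hb
    refine ⟨k, b, by simp, hk, ?_⟩
    cases hs : d s n with
    | none => rfl
    | some c => exact Part.mem_unique ((h n).2 c ((hdφ n c).2 ⟨s, hs⟩)) hb
  · intro h n
    have hval (s : ℕ) : ∃ b ∈ Ψ X n, (d s n).getD b = b := by
      obtain ⟨k, b, -, hk, hb⟩ := h (s, n)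
      exact ⟨b, (hΨR X n b).2 ⟨k, hk⟩, hb⟩
    refine ⟨Part.dom_iff_mem.2 ((hval 0).imp fun b hb => hb.1), fun b hb => ?_⟩
    obtain ⟨s, hs⟩ := (hdφ n b).1 hb
    obtain ⟨c, hc, hbc⟩ := hval s
    have hbc : b = c := by simpa [Option.mem_def.1 hs] using hbc
    exact hbc ▸ hc

theorem rhoBelow_mem_Icc (S : Set ℕ) (n : ℕ) : rhoBelow S n ∈ Set.Icc (0 : ℝ) 1 := by
  refine ⟨by unfold rhoBelow; positivity, div_le_one_of_le₀ ?_ (Nat.cast_nonneg n)⟩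
  have h : (S ∩ Set.Iio n).ncard ≤ (Set.Iio n).ncard :=
    Set.ncard_le_ncard Set.inter_subset_right (Set.finite_Iio n)
  rw [← Finset.coe_Iio, Set.ncard_coe_finset, Nat.card_Iio] at h
  exact_mod_cast h

theorem lowerDensity_mono {S T : Set ℕ} (h : S ⊆ T) : lowerDensity S ≤ lowerDensity T := by
  refine liminf_le_liminf (Eventually.of_forall fun n => ?_)
    (isBoundedUnder_of ⟨0, fun n => (rhoBelow_mem_Icc S n).1⟩)
    (IsBoundedUnder.isCoboundedUnder_ge (isBoundedUnder_of ⟨1, fun n => (rhoBelow_mem_Icc T n).2⟩))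
  unfold rhoBelow
  gcongr
  exact (Set.finite_Iio n).inter_of_right T

theorem coarselyComputableAtDensity_of_extends {B : Set ℕ} {r : ℝ} {C : ℕ → Bool}
    (hC : Computable C) {φ : ℕ →. Bool} (hφB : ∀ n, ∀ b ∈ φ n, b = charSeq B n)
    (hφC : ∀ n, ∀ b ∈ φ n, b = C n) (hr : r ≤ lowerDensity φ.Dom) :
    CoarselyComputableAtDensity B r := by
  refine ⟨{n | C n = true}, ComputablePred.computable_iff.2 ⟨C, hC, rfl⟩,
    hr.trans (lowerDensity_mono fun n hn => ?_)⟩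
  obtain ⟨b, hb⟩ := Part.dom_iff_mem.1 hn
  have hBC : charSeq B n = C n := (hφB n b hb).symm.trans (hφC n b hb)
  simp [← hBC, charSeq]

theorem IsTuringFunctional.coarselyComputableAtDensity {Ψ : (ℕ → Bool) → ℕ →. Bool}
    (hΨ : IsTuringFunctional Ψ) {φ : ℕ →. Bool} {P : Set (ℕ → Bool)} (hP : cantorMeasure P ≠ 0)
    (hPΨ : ∀ X ∈ P, ∀ n, (Ψ X n).Dom ∧ ∀ b ∈ φ n, b ∈ Ψ X n) {B : Set ℕ} {r : ℝ}
    (hφB : ∀ n, ∀ b ∈ φ n, b = charSeq B n) (hr : r ≤ lowerDensity φ.Dom) :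
    CoarselyComputableAtDensity B r := by
  obtain ⟨C, hC, hCΨ⟩ := hΨ.exists_computable_selection hP fun X hX n => (hPΨ X hX n).1
  refine coarselyComputableAtDensity_of_extends hC hφB (fun n b hb => ?_) hr
  obtain ⟨X, hXP, hX⟩ := hCΨ n
  exact Part.mem_unique ((hPΨ X hXP n).2 b hb) hX

theorem coarselyComputableAtDensity_of_ttReducible {A B : Set ℕ} {r : ℝ} (hA : WeaklyRandom 1 A)
    (hBA : SetTTReducible B A) (hB : PartiallyComputableAtDensity B r) :
    CoarselyComputableAtDensity B r := by
  obtain ⟨f, hf, hfB⟩ := hBA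
  obtain ⟨φ, hφ, hφB, hr⟩ := hB
  let Ψ (X : ℕ → Bool) (n : ℕ) : Part Bool := Part.some (decide ((f n).1.map X ∈ (f n).2))
  have hΨ : IsTuringFunctional Ψ := isTuringFunctional_truthTable hf
  have hΨA (n : ℕ) : Ψ (charSeq A) n = Part.some (charSeq B n) :=
    congrArg Part.some (decide_eq_decide.2 (hfB n).symm)
  refine hΨ.coarselyComputableAtDensity (P := {X | ∀ n, ∀ b ∈ φ n, b ∈ Ψ X n}) (fun h0 => ?_)
    (fun X hX n => ⟨trivial, hX n⟩) hφB hr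
  refine hA _ (hΨ.isPiClass_one_setOf_extends (fun _ _ => trivial) hφ) h0 fun n b hb => ?_
  exact hΨA n ▸ Part.mem_some_iff.2 (hφB n b hb)

theorem coarselyComputableAtDensity_of_turingReducible {A B : Set ℕ} {r : ℝ}
    (hA : WeaklyRandom 2 A) (hBA : SetTuringReducible B A)
    (hB : PartiallyComputableAtDensity B r) : CoarselyComputableAtDensity B r := by
  obtain ⟨Ψ, hΨ, hΨA⟩ := hBA.exists_isTuringFunctional
  obtain ⟨φ, hφ, hφB, hr⟩ := hB
  refine hΨ.coarselyComputableAtDensity (P := {X | ∀ n, (Ψ X n).Dom ∧ ∀ b ∈ φ n, b ∈ Ψ X n})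
    (fun h0 => ?_) (fun _ hX => hX) hφB hr
  refine hA _ (hΨ.isPiClass_two_setOf_total_extends hφ) h0 fun n => ?_
  rw [hΨA]
  exact ⟨trivial, fun b hb => Part.mem_some_iff.2 (hφB n b hb)⟩

end CoarseComputability

theorem theorem5p3 (A B : Set ℕ) (r : ℝ) (hr : r ∈ Set.Icc (0 : ℝ) 1) :
    (CoarseComputability.WeaklyRandom 1 A →
      CoarseComputability.SetTTReducible B A →
      CoarseComputability.PartiallyComputableAtDensity B r →
      CoarseComputability.CoarselyComputableAtDensity B r) ∧
    (CoarseComputability.WeaklyRandom 2 A →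
      CoarseComputability.SetTuringReducible B A →
      CoarseComputability.PartiallyComputableAtDensity B r →
      CoarseComputability.CoarselyComputableAtDensity B r) :=
  ⟨CoarseComputability.coarselyComputableAtDensity_of_ttReducible,
    CoarseComputability.coarselyComputableAtDensity_of_turingReducible⟩
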